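/- Let $M$ be a finite monoid that is $\mathscr J$-trivial, i.e. $MmM=MnM$ implies $m=n$ for all $m,n\in M$, let $E(M)$ be its set of idempotents, and let $k$ be any field. The Karoubi envelope $\mathscr K(M)$ is the category with object set $E(M)$, with $\mathscr K(M)(e,f)=fMe$, and with composition given by the multiplication of $M$. A morphism $p\colon c\to d$ of a category $\mathscr C$ is irreducible if it is neither a split monomorphism nor a split epimorphism and whenever $p=gh$, either $h$ is a split monomorphism or $g$ is a split epimorphism; $\mathsf{Irr}_{\mathscr C}(c,d)$ denotes the set of irreducible morphisms $c\to d$. The quiver $Q(\mathscr C)$ of a small category $\mathscr C$ has as vertices the isomorphism classes of objects and as arrows the irreducible morphisms between fixed representatives of these classes. For a finite dimensional $k$-algebra $A$ that is split over $k$ (i.e. $A/\mathrm{rad}(A)$ is isomorphic to a finite product of matrix algebras over $k$), the quiver $Q(A)$ has as vertices the isomorphism classes of simple left $A$-modules, and the number of arrows from $S$ to $T$ is $\dim_k\mathrm{Ext}^1_A(S,T)$. Then the monoid algebra $kM$ is split over $k$, and $Q(kM)=Q(\mathscr K(M))$ (as an isomorphism of quivers). That is: distinct idempotents are non-isomorphic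 objects of $\mathscr K(M)$, so that the vertex set of $Q(\mathscr K(M))$ is $E(M)$; the vertex set of $Q(kM)$ is $E(M)$, where $e\in E(M)$ corresponds to the isomorphism class of the simple $kM$-modules on which $m\in M$ acts as the identity if $e\in MmM$ and as $0$ otherwise; and, for all $e,f\in E(M)$, the set of arrows from $e$ to $f$ is $\mathsf{Irr}_{\mathscr K(M)}(e,f)$. -/

import Mathlib

open CategoryTheory

universe u v

/-- The principal two-sided ideal `M m M` of a monoid. -/
def principalIdeal {M : Type u} [Monoid M] (m : M) : Set M :=
  {x | ∃ a b : M, x = a * m * b}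

/-- A monoid is `J`-trivial if distinct elements generate distinct principal two-sided ideals. -/
def IsJTrivial (M : Type u) [Monoid M] : Prop :=
  ∀ m n : M, principalIdeal m = principalIdeal n → m = n

/-- The Karoubi envelope of a monoid. The composition of `SingleObj M` is `f ≫ g = g * f`, so a
morphism from the idempotent `e` to the idempotent `f` is an element `m` of `M` with
`f * m * e = m` (that is, `m ∈ f M e`), and composition is multiplication in `M`. -/
abbrev MonoidKaroubi (M : Type u) [Monoid M] : Type u :=
  Idempotents.Karoubi (SingleObj M)

/-- The idempotent `e`, seen as an object of the Karoubi envelope. -/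
def MonoidKaroubi.ofIdem {M : Type u} [Monoid M] (e : {e : M // IsIdempotentElem e}) :
    MonoidKaroubi M where
  X := SingleObj.star M
  p := (e : M)
  idem := e.2

/-- The objects of the Karoubi envelope are exactly the idempotents. -/
theorem MonoidKaroubi.ofIdem_bijective (M : Type u) [Monoid M] :
    Function.Bijective (MonoidKaroubi.ofIdem (M := M)) := by
  constructor
  · rintro ⟨e, he⟩ ⟨f, hf⟩ h
    cases h
    rfl
  · rintro ⟨⟨⟩, p, hp⟩
    exact ⟨⟨p, hp⟩, rfl⟩

/-- The morphisms `e ⟶ f` of the Karoubi envelope are exactly the elements of `f M e`. -/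
def MonoidKaroubi.homEquiv {M : Type u} [Monoid M] (e f : {e : M // IsIdempotentElem e}) :
    (MonoidKaroubi.ofIdem e ⟶ MonoidKaroubi.ofIdem f) ≃
      {m : M // ∃ x : M, m = (f : M) * x * (e : M)} where
  toFun h := ⟨h.f, h.f, h.comm.symm⟩
  invFun m := ⟨m.1, by
    obtain ⟨_, x, rfl⟩ := m
    change (f : M) * ((f : M) * x * (e : M)) * (e : M) = (f : M) * x * (e : M)
    have he : (e : M) * e = e := e.2
    have hf : (f : M) * f = f := f.2
    simp only [mul_assoc, he]
    simp only [← mul_assoc, hf]⟩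
  left_inv _ := rfl
  right_inv _ := rfl

/-- A morphism is irreducible if it is neither a split monomorphism nor a split epimorphism, and
whenever it factors as `h` followed by `g`, either `h` is a split monomorphism or `g` is a split
epimorphism. -/
def IsIrreducibleHom {C : Type u} [Category.{v} C] {c d : C} (f : c ⟶ d) : Prop :=
  ¬ IsSplitMono f ∧ ¬ IsSplitEpi f ∧
    ∀ (x : C) (h : c ⟶ x) (g : x ⟶ d), f = h ≫ g → IsSplitMono h ∨ IsSplitEpi g

/-- The set of irreducible morphisms from `c` to `d`. -/
def IrrHom {C : Type u} [Category.{v} C] (c d : C) : Type v :=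
  {f : c ⟶ d // IsIrreducibleHom f}

/-- The quiver of a small category: the vertices are the isomorphism classes of objects. -/
def CatQuiver (C : Type u) [Category.{v} C] : Type u :=
  Quotient (isIsomorphicSetoid C)

/-- The vertex of the quiver of a category given by an object. -/
def CatQuiver.mk {C : Type u} [Category.{v} C] (c : C) : CatQuiver C :=
  Quotient.mk (isIsomorphicSetoid C) c

/-- The arrows of the quiver of a category are the irreducible morphisms between fixed
representatives of the isomorphism classes. -/
noncomputable instance CatQuiver.instQuiver (C : Type u) [Category.{v} C] :
    Quiver (CatQuiver C) where
  Hom a b := IrrHom (Quotient.out a) (Quotient.out b)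

/-- A finite dimensional `k`-algebra is split over `k` if its quotient by the Jacobson radical is
isomorphic to a finite product of matrix algebras over `k`. -/
def IsSplitAlgebra (k : Type u) [Field k] (A : Type v) [Ring A] [Algebra k A] : Prop :=
  ∃ (n : ℕ) (d : Fin n → ℕ), (∀ i, d i ≠ 0) ∧
    Nonempty ((A ⧸ Ring.jacobson A) ≃ₐ[k] (∀ i, Matrix (Fin (d i)) (Fin (d i)) k))

/-- Simple left modules over a ring. -/
def SimpleMod (A : Type v) [Ring A] : Type (v + 1) :=
  {S : ModuleCat.{v} A // IsSimpleModule A S}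

/-- Isomorphism of simple modules. -/
def simpleModSetoid (A : Type v) [Ring A] : Setoid (SimpleMod A) where
  r S T := Nonempty (S.1 ≃ₗ[A] T.1)
  iseqv :=
    { refl := fun S => ⟨LinearEquiv.refl A S.1⟩
      symm := fun ⟨e⟩ => ⟨e.symm⟩
      trans := fun ⟨e⟩ ⟨f⟩ => ⟨e.trans f⟩ }

/-- The Gabriel quiver of a finite dimensional split `k`-algebra: the vertices are the isomorphism
classes of simple left modules. -/
def GabrielQuiver (k : Type u) [Field k] (A : Type v) [Ring A] [Algebra k A] : Type (v + 1) :=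
  Quotient (simpleModSetoid A)

/-- The vertex of the Gabriel quiver given by a simple module. -/
def GabrielQuiver.mk (k : Type u) [Field k] {A : Type v} [Ring A] [Algebra k A]
    (S : SimpleMod A) : GabrielQuiver k A :=
  Quotient.mk (simpleModSetoid A) S

/-- The arrows of the Gabriel quiver from the class of `S` to the class of `T` form a set with
`dim_k Ext¹_A(S, T)` elements. -/
noncomputable instance GabrielQuiver.instQuiver (k : Type u) [Field k] (A : Type v) [Ring A]
    [Algebra k A] : Quiver (GabrielQuiver k A) where
  Hom a b :=
    Quotient.out (Module.rank k (Abelian.Ext (Quotient.out a).1 (Quotient.out b).1 1))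

/-- An isomorphism of quivers: a bijection of the vertices with bijections of the arrow sets. -/
structure QuiverIso (V : Type*) [Quiver V] (W : Type*) [Quiver W] where
  /-- the bijection of the vertices -/
  vertexEquiv : V ≃ W
  /-- the bijections of the arrow sets -/
  arrowEquiv : ∀ a b : V, (a ⟶ b) ≃ (vertexEquiv a ⟶ vertexEquiv b)

/-- Every element `m` of `M` acts on the `k M`-module `S` as the identity if `e ∈ M m M`, and as
zero otherwise. -/
def ActsAsIdem (k : Type v) [Field k] {M : Type u} [Monoid M] (e : M)
    (S : Type*) [AddCommGroup S] [Module (MonoidAlgebra k M) S] : Prop :=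
  ∀ (m : M) (x : S),
    (e ∈ principalIdeal m → MonoidAlgebra.of k M m • x = x) ∧
    (e ∉ principalIdeal m → MonoidAlgebra.of k M m • x = 0)

/-! In a `J`-trivial monoid the conditions `e ∈ M m M`, `m * e = e` and `e * m = e` agree for an
idempotent `e`, and the elements satisfying them form a submonoid whose complement is an ideal. So
every idempotent carries a 0-1 valued character χ_e (`idemChar`). These exhaust the simple modules
(`exists_actsAsIdem`), and their independence makes `kM` modulo its radical a product of copies of
`k`.

For `Ext¹(S_e, S_f)`, resolve `S_e` by `0 → ker χ_e → kM → S_e → 0`. Maps `ker χ_e → S_f` amount to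
derivations `d(mn) = χ_f(m) d(n) + χ_e(n) d(m)` on `M`; those extending to `kM` are the inner ones
`(χ_f - χ_e) c`. A derivation is restricted to the irreducible elements of `f M e`. Both characters
vanish there, so inner derivations die; conversely a derivation vanishing there is inner
(`IsIdemDerivation.exists_eq_smul`), and every function there extends (`irrDerivation`). Hence
`Ext¹` is the space of `S_f`-valued functions on the irreducibles, with `S_f` one-dimensional.

In the Karoubi envelope, a split mono `e ⟶ f` has underlying element `e` and a split epi has `f`;
irreducibility thus becomes a condition on factorizations in `M`, and isomorphic objects coincide.
-/

/-! ### Idempotents of a `J`-trivial monoid and their characters. -/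

section JTrivial

variable {M : Type u} [Monoid M]

theorem IsJTrivial.eq_of_mem (hM : IsJTrivial M) {a b : M} (hab : a ∈ principalIdeal b)
    (hba : b ∈ principalIdeal a) : a = b := by
  apply hM
  obtain ⟨x, y, h1⟩ := hab
  obtain ⟨z, w, h2⟩ := hba
  ext c
  constructor
  · rintro ⟨p, q, rfl⟩
    exact ⟨p * x, y * q, by rw [h1]; simp only [mul_assoc]⟩
  · rintro ⟨p, q, rfl⟩
    exact ⟨p * z, w * q, by rw [h2]; simp only [mul_assoc]⟩

/-- In a `J`-trivial monoid, an idempotent below `m` is fixed by `m` on both sides. -/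
theorem IsJTrivial.mul_eq_of_mem (hM : IsJTrivial M) {e m : M} (he : IsIdempotentElem e)
    (h : e ∈ principalIdeal m) : e * m = e ∧ m * e = e := by
  obtain ⟨a, b, hab⟩ := h
  have he : e * e = e := he
  -- Since `e = e * e = (e * a) * (m * b)`, the elements `e` and `e * a` generate the same ideal;
  -- dually for `b * e`.
  have h1 : e * a = e := hM.eq_of_mem ⟨1, a, by simp⟩
    ⟨1, m * b, by
      calc e = e * (a * m * b) := by rw [← hab, he]
        _ = 1 * (e * a) * (m * b) := by simp only [mul_assoc, one_mul]⟩
  have h2 : b * e = e := hM.eq_of_mem ⟨b, 1, by simp⟩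
    ⟨a * m, 1, by
      calc e = (a * m * b) * e := by rw [← hab, he]
        _ = a * m * (b * e) * 1 := by simp only [mul_assoc, mul_one]⟩
  constructor
  · exact hM.eq_of_mem ⟨1, m, by simp⟩
      ⟨1, b, by
        calc e = e * (a * m * b) := by rw [← hab, he]
          _ = (e * a) * m * b := by simp only [mul_assoc]
          _ = 1 * (e * m) * b := by rw [h1, one_mul]⟩
  · exact hM.eq_of_mem ⟨m, 1, by simp⟩
      ⟨a, 1, by
        calc e = (a * m * b) * e := by rw [← hab, he]
          _ = a * m * (b * e) := by simp only [mul_assoc]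
          _ = a * (m * e) * 1 := by rw [h2, mul_one, mul_assoc]⟩

theorem IsJTrivial.mem_principalIdeal_iff (hM : IsJTrivial M) {e m : M}
    (he : IsIdempotentElem e) : e ∈ principalIdeal m ↔ m * e = e :=
  ⟨fun h => (hM.mul_eq_of_mem he h).2, fun h => ⟨1, e, by rw [one_mul, h]⟩⟩

theorem IsJTrivial.mul_eq_left_iff (hM : IsJTrivial M) {e m : M}
    (he : IsIdempotentElem e) : m * e = e ↔ e * m = e :=
  ⟨fun h => (hM.mul_eq_of_mem he ((hM.mem_principalIdeal_iff he).2 h)).1,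
    fun h => (hM.mul_eq_of_mem he ⟨e, 1, by rw [mul_one, h]⟩).2⟩

/-- If `e` lies below a product, it lies below each factor. This is what makes the 0-1 function of
`idemChar` multiplicative. -/
theorem IsJTrivial.mul_mul_eq_iff (hM : IsJTrivial M) {e : M} (he : IsIdempotentElem e)
    (m n : M) : m * n * e = e ↔ m * e = e ∧ n * e = e := by
  constructor
  · intro h
    rw [← hM.mem_principalIdeal_iff he] at h
    obtain ⟨a, b, hab⟩ := h
    constructor
    · exact (hM.mul_eq_of_mem he ⟨a, n * b, by rw [hab]; simp only [mul_assoc]⟩).2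
    · exact (hM.mul_eq_of_mem he ⟨a * m, b, by rw [hab]; simp only [mul_assoc]⟩).2
  · rintro ⟨h1, h2⟩
    rw [mul_assoc, h2, h1]

open Classical in
/-- The character of a `J`-trivial monoid at an idempotent `e`: it is `1` on the elements
above `e`, and `0` on the others. -/
noncomputable def idemChar (hM : IsJTrivial M) (k : Type v) [Field k]
    (e : {e : M // IsIdempotentElem e}) : M →* k where
  toFun m := if m * (e : M) = e then 1 else 0
  map_one' := by simp
  map_mul' m n := by
    by_cases h1 : m * (e : M) = e <;> by_cases h2 : n * (e : M) = e <;>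
      simp [hM.mul_mul_eq_iff e.2, h1, h2]

variable (hM : IsJTrivial M) (k : Type v) [Field k] (e f : {e : M // IsIdempotentElem e})

theorem idemChar_of_eq {m : M} (h : m * (e : M) = e) : idemChar hM k e m = 1 := by
  simp [idemChar, h]

theorem idemChar_of_ne {m : M} (h : m * (e : M) ≠ e) : idemChar hM k e m = 0 := by
  simp [idemChar, h]

theorem idemChar_self : idemChar hM k e e = 1 := idemChar_of_eq hM k e e.2

/-- Evaluating the common character at `e` and at `f` puts each idempotent above the other;
left-right symmetry of fixing then identifies them. -/
theorem idemChar_injective : Function.Injective (idemChar hM k) := by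
  intro e f h
  have h1 : (e : M) * f = f := by
    by_contra h1
    have := idemChar_self hM k e
    rw [h, idemChar_of_ne hM k f h1] at this
    exact zero_ne_one this
  have h2 : (f : M) * e = e := by
    by_contra h2
    have := idemChar_self hM k f
    rw [← h, idemChar_of_ne hM k e h2] at this
    exact zero_ne_one this
  exact Subtype.ext (((hM.mul_eq_left_iff e.2).1 h2).symm.trans h1)

/-- The linear extension of the character of an idempotent to the monoid algebra. -/
noncomputable def idemAlgHom : MonoidAlgebra k M →ₐ[k] k :=
  MonoidAlgebra.lift k k M (idemChar hM k e)

@[simp]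
theorem idemAlgHom_of (m : M) :
    idemAlgHom hM k e (MonoidAlgebra.of k M m) = idemChar hM k e m :=
  MonoidAlgebra.lift_of _ _

@[simp]
theorem idemAlgHom_single (m : M) (c : k) :
    idemAlgHom hM k e (MonoidAlgebra.single m c) = c * idemChar hM k e m := by
  simp [idemAlgHom]

theorem actsAsIdem_iff (S : Type*) [AddCommGroup S] [Module (MonoidAlgebra k M) S] [Module k S]
    [IsScalarTower k (MonoidAlgebra k M) S] :
    ActsAsIdem k (e : M) S ↔ ∀ (a : MonoidAlgebra k M) (x : S), a • x = idemAlgHom hM k e a • x := by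
  constructor
  · intro h a x
    induction a using MonoidAlgebra.induction_on with
    | of m =>
      by_cases hm : m * (e : M) = e
      · rw [(h m x).1 ((hM.mem_principalIdeal_iff e.2).2 hm), idemAlgHom_of,
          idemChar_of_eq hM k e hm, one_smul]
      · rw [(h m x).2 (fun h' => hm ((hM.mem_principalIdeal_iff e.2).1 h')), idemAlgHom_of,
          idemChar_of_ne hM k e hm, zero_smul]
    | add a b ha hb => rw [add_smul, ha, hb, map_add, add_smul]
    | smul r a ha => rw [smul_assoc, ha, map_smul, smul_assoc]
  · intro h m x
    rw [h, idemAlgHom_of, hM.mem_principalIdeal_iff e.2]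
    exact ⟨fun hm => by rw [idemChar_of_eq hM k e hm, one_smul],
      fun hm => by rw [idemChar_of_ne hM k e hm, zero_smul]⟩

end JTrivial

/-! ### Irreducible morphisms of the Karoubi envelope. -/

section Irreducible

variable {M : Type u} [Monoid M]

/-- The elements of `f M e` that are irreducible as morphisms from `e` to `f`. -/
def IsIrreducibleBetween (e f m : M) : Prop :=
  f * m = m ∧ m * e = m ∧ m ≠ e ∧ m ≠ f ∧
    ∀ g h : M, m = g * h → f * g = g → h * e = h → h = e ∨ g = f

/-- The element of the monoid underlying a morphism of the Karoubi envelope. -/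
def MonoidKaroubi.elt {a b : MonoidKaroubi M} (h : a ⟶ b) : M := h.f

/-- The idempotent underlying an object of the Karoubi envelope. -/
def MonoidKaroubi.idem (a : MonoidKaroubi M) : M := a.p

theorem MonoidKaroubi.idem_mul_idem (a : MonoidKaroubi M) : idem a * idem a = idem a :=
  Idempotents.Karoubi.idem a

theorem MonoidKaroubi.elt_mul_idem {a b : MonoidKaroubi M} (h : a ⟶ b) :
    elt h * idem a = elt h := Idempotents.Karoubi.p_comp h

theorem MonoidKaroubi.idem_mul_elt {a b : MonoidKaroubi M} (h : a ⟶ b) :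
    idem b * elt h = elt h := Idempotents.Karoubi.comp_p h

theorem MonoidKaroubi.elt_of_comp {a b c : MonoidKaroubi M} {f : a ⟶ c} {h : a ⟶ b} {g : b ⟶ c}
    (hf : f = h ≫ g) : elt f = elt g * elt h := congrArg Idempotents.Karoubi.Hom.f hf

/-- A retraction puts the source idempotent in the ideal of `elt h`, and `elt h * idem a = elt h`
gives the reverse inclusion. Conversely, `idem a * idem b` serves as retraction. -/
theorem MonoidKaroubi.isSplitMono_iff (hM : IsJTrivial M) {a b : MonoidKaroubi M} (h : a ⟶ b) :
    IsSplitMono h ↔ elt h = idem a := by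
  have ha := idem_mul_idem a
  constructor
  · rintro ⟨⟨r, hr⟩⟩
    have hr : elt r * elt h = idem a :=
      (elt_of_comp hr.symm).symm
    exact hM.eq_of_mem ⟨elt h, 1, by rw [mul_one, elt_mul_idem]⟩ ⟨elt r, 1, by rw [mul_one, hr]⟩
  · intro hh
    have h1 : idem b * idem a = idem a := by
      rw [← hh, idem_mul_elt]
    refine ⟨⟨⟨idem a * idem b, ?_⟩, ?_⟩⟩
    · change idem a * (idem a * idem b) * idem b = _
      have hb := idem_mul_idem b
      rw [← mul_assoc, ha, mul_assoc, hb]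
    · ext
      change idem a * idem b * elt h = idem a
      rw [hh, mul_assoc, h1, ha]

theorem MonoidKaroubi.isSplitEpi_iff (hM : IsJTrivial M) {a b : MonoidKaroubi M} (h : a ⟶ b) :
    IsSplitEpi h ↔ elt h = idem b := by
  have hb := idem_mul_idem b
  constructor
  · rintro ⟨⟨r, hr⟩⟩
    have hr : elt h * elt r = idem b :=
      (elt_of_comp hr.symm).symm
    exact hM.eq_of_mem ⟨1, elt h, by rw [one_mul, idem_mul_elt]⟩ ⟨1, elt r, by rw [one_mul, hr]⟩
  · intro hh
    have h1 : idem b * idem a = idem b := by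
      rw [← hh, elt_mul_idem]
    have ha := idem_mul_idem a
    refine ⟨⟨⟨idem a * idem b, ?_⟩, ?_⟩⟩
    · change idem a * (idem a * idem b) * idem b = _
      rw [← mul_assoc, ha, mul_assoc, hb]
    · ext
      change elt h * (idem a * idem b) = idem b
      rw [hh, ← mul_assoc, h1, hb]

theorem MonoidKaroubi.isIrreducibleHom_iff (hM : IsJTrivial M)
    {e f : {e : M // IsIdempotentElem e}} (h : ofIdem e ⟶ ofIdem f) :
    IsIrreducibleHom h ↔ IsIrreducibleBetween (e : M) (f : M) (elt h) := by
  rw [IsIrreducibleHom, isSplitMono_iff hM, isSplitEpi_iff hM]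
  constructor
  · rintro ⟨h1, h2, h3⟩
    refine ⟨idem_mul_elt h, elt_mul_idem h, h1, h2, fun g h' hgh hg hh => ?_⟩
    -- The object `1` imposes no condition on the middle of a factorization, so every factorization
    -- in `M` passes through it.
    let p : ofIdem e ⟶ ofIdem ⟨1, mul_one 1⟩ :=
      ⟨h', by change (1 : M) * h' * (e : M) = h'; rw [one_mul, hh]⟩
    let q : ofIdem ⟨1, mul_one 1⟩ ⟶ ofIdem f :=
      ⟨g, by change (f : M) * g * 1 = g; rw [mul_one, hg]⟩
    have := h3 _ p q (Idempotents.Karoubi.Hom.ext hgh)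
    rwa [isSplitMono_iff hM, isSplitEpi_iff hM] at this
  · rintro ⟨-, -, h1, h2, h3⟩
    refine ⟨h1, h2, fun x h' g hgh => ?_⟩
    rw [isSplitMono_iff hM, isSplitEpi_iff hM]
    exact h3 (elt g) (elt h') (elt_of_comp hgh) (idem_mul_elt g) (elt_mul_idem h')

/-- Irreducible morphisms of the Karoubi envelope as elements of the monoid. -/
def MonoidKaroubi.irrHomEquiv (hM : IsJTrivial M) (e f : {e : M // IsIdempotentElem e}) :
    IrrHom (ofIdem e) (ofIdem f) ≃ {m : M // IsIrreducibleBetween (e : M) (f : M) m} where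
  toFun h := ⟨elt h.1, (isIrreducibleHom_iff hM h.1).1 h.2⟩
  invFun m := ⟨⟨m.1, by
      change (f : M) * m.1 * (e : M) = m.1
      rw [m.2.1, m.2.2.1]⟩, (isIrreducibleHom_iff hM _).2 m.2⟩
  left_inv _ := rfl
  right_inv _ := rfl

theorem MonoidKaroubi.eq_of_iso (hM : IsJTrivial M) {a b : MonoidKaroubi M} (i : a ≅ b) :
    a = b := by
  have h1 := (isSplitMono_iff hM i.hom).1 inferInstance
  have h2 := (isSplitEpi_iff hM i.hom).1 inferInstance
  obtain ⟨⟨⟩, p, hp⟩ := a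
  obtain ⟨⟨⟩, q, hq⟩ := b
  obtain rfl : p = q := h1.symm.trans h2
  rfl

theorem CatQuiver.mk_injective (hM : IsJTrivial M) :
    Function.Injective (CatQuiver.mk (C := MonoidKaroubi M)) := by
  intro a b h
  obtain ⟨i⟩ := Quotient.exact h
  exact MonoidKaroubi.eq_of_iso hM i

theorem CatQuiver.out_mk (hM : IsJTrivial M) (a : MonoidKaroubi M) :
    Quotient.out (CatQuiver.mk a) = a :=
  CatQuiver.mk_injective hM (Quotient.out_eq (CatQuiver.mk a))

theorem CatQuiver.mk_ofIdem_bijective (hM : IsJTrivial M) :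
    Function.Bijective (fun e : {e : M // IsIdempotentElem e} =>
      CatQuiver.mk (MonoidKaroubi.ofIdem e)) :=
  Function.Bijective.comp ⟨CatQuiver.mk_injective hM, Quotient.mk_surjective⟩
    (MonoidKaroubi.ofIdem_bijective M)

end Irreducible

/-! ### Simple modules and the radical of the monoid algebra. -/

section Simple

variable {M : Type u} [Monoid M] (hM : IsJTrivial M) (k : Type v) [Field k]
  (e f : {e : M // IsIdempotentElem e})

theorem isCoatom_ker_idemAlgHom : IsCoatom (RingHom.ker (idemAlgHom hM k e)) := by
  refine ⟨fun h => ?_, fun I hI => ?_⟩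
  · have : (1 : MonoidAlgebra k M) ∈ RingHom.ker (idemAlgHom hM k e) := h ▸ Submodule.mem_top
    rw [RingHom.mem_ker, map_one] at this
    exact one_ne_zero this
  · obtain ⟨hle, x, hxI, hx⟩ := SetLike.lt_iff_le_and_exists.1 hI
    rw [RingHom.mem_ker] at hx
    rw [Ideal.eq_top_iff_one]
    have h1 : 1 - algebraMap k (MonoidAlgebra k M) (idemAlgHom hM k e x)⁻¹ * x ∈ I :=
      hle (by rw [RingHom.mem_ker]; simp [hx])
    simpa using I.add_mem h1
      (I.mul_mem_left (algebraMap k _ (idemAlgHom hM k e x)⁻¹) hxI)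

/-- The simple module at the idempotent `e`. -/
noncomputable def idemSimpleMod : SimpleMod (MonoidAlgebra k M) :=
  ⟨ModuleCat.of _ (MonoidAlgebra k M ⧸ RingHom.ker (idemAlgHom hM k e)),
    isSimpleModule_iff_isCoatom.2 (isCoatom_ker_idemAlgHom hM k e)⟩

theorem actsAsIdem_quotient_ker :
    ActsAsIdem k (e : M) (MonoidAlgebra k M ⧸ RingHom.ker (idemAlgHom hM k e)) := by
  rw [actsAsIdem_iff hM]
  intro a x
  obtain ⟨x, rfl⟩ := Submodule.Quotient.mk_surjective _ x
  rw [← Submodule.Quotient.mk_smul, ← Submodule.Quotient.mk_smul, Submodule.Quotient.eq,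
    RingHom.mem_ker]
  simp

variable {S : Type*} [AddCommGroup S] [Module (MonoidAlgebra k M) S]
  {T : Type*} [AddCommGroup T] [Module (MonoidAlgebra k M) T]

variable {k} in
theorem ActsAsIdem.of_linearEquiv {e : M} (i : S ≃ₗ[MonoidAlgebra k M] T)
    (h : ActsAsIdem k e S) : ActsAsIdem k e T := fun m x =>
  ⟨fun hm => i.symm.injective (by rw [map_smul, (h m _).1 hm]),
    fun hm => i.symm.injective (by rw [map_smul, (h m _).2 hm, map_zero])⟩

theorem ActsAsIdem.ker_toSpanSingleton (hS : ActsAsIdem k (e : M) S) {s : S} (hs : s ≠ 0) :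
    LinearMap.ker (LinearMap.toSpanSingleton (MonoidAlgebra k M) S s) =
      RingHom.ker (idemAlgHom hM k e) := by
  let _ := Module.restrictScalars k (MonoidAlgebra k M) S
  have := IsScalarTower.restrictScalars k (MonoidAlgebra k M) S
  ext a
  rw [LinearMap.mem_ker, LinearMap.toSpanSingleton_apply, RingHom.mem_ker,
    (actsAsIdem_iff hM k e S).1 hS, smul_eq_zero_iff_left hs]

include hM in
theorem ActsAsIdem.nonempty_linearEquiv [IsSimpleModule (MonoidAlgebra k M) S]
    [IsSimpleModule (MonoidAlgebra k M) T]
    (hS : ActsAsIdem k (e : M) S) (hT : ActsAsIdem k (e : M) T) :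
    Nonempty (S ≃ₗ[MonoidAlgebra k M] T) := by
  have := IsSimpleModule.nontrivial (MonoidAlgebra k M) S
  have := IsSimpleModule.nontrivial (MonoidAlgebra k M) T
  obtain ⟨s, hs⟩ := exists_ne (0 : S)
  obtain ⟨t, ht⟩ := exists_ne (0 : T)
  exact ⟨(LinearMap.quotKerEquivOfSurjective _
      (IsSimpleModule.toSpanSingleton_surjective _ hs)).symm ≪≫ₗ
    Submodule.quotEquivOfEq _ _ ((hS.ker_toSpanSingleton hM k e hs).trans
      (hT.ker_toSpanSingleton hM k e ht).symm) ≪≫ₗ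
    LinearMap.quotKerEquivOfSurjective _ (IsSimpleModule.toSpanSingleton_surjective _ ht)⟩

include hM in
theorem ActsAsIdem.finrank_eq_one [IsSimpleModule (MonoidAlgebra k M) S] [Module k S]
    [IsScalarTower k (MonoidAlgebra k M) S] (hS : ActsAsIdem k (e : M) S) :
    Module.finrank k S = 1 := by
  have := IsSimpleModule.nontrivial (MonoidAlgebra k M) S
  obtain ⟨s, hs⟩ := exists_ne (0 : S)
  refine _root_.finrank_eq_one s hs fun w => ?_
  obtain ⟨a, rfl⟩ := IsSimpleModule.toSpanSingleton_surjective (MonoidAlgebra k M) hs w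
  exact ⟨idemAlgHom hM k e a, ((actsAsIdem_iff hM k e S).1 hS a s).symm⟩

include hM in
theorem ActsAsIdem.eq [Nontrivial S] (hS : ActsAsIdem k (e : M) S)
    (hS' : ActsAsIdem k (f : M) S) : e = f := by
  let _ := Module.restrictScalars k (MonoidAlgebra k M) S
  have := IsScalarTower.restrictScalars k (MonoidAlgebra k M) S
  obtain ⟨s, hs⟩ := exists_ne (0 : S)
  apply idemChar_injective hM k
  ext m
  have h := (actsAsIdem_iff hM k e S).1 hS (MonoidAlgebra.of k M m) s
  rw [(actsAsIdem_iff hM k f S).1 hS', idemAlgHom_of, idemAlgHom_of] at h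
  exact (smul_left_injective k hs h).symm

include hM in
/-- Every simple module of the algebra of a finite `J`-trivial monoid is the simple module of an
idempotent. -/
theorem exists_actsAsIdem [Finite M] [IsSimpleModule (MonoidAlgebra k M) S] :
    ∃ e : {e : M // IsIdempotentElem e}, ActsAsIdem k (e : M) S := by
  let _ := Module.restrictScalars k (MonoidAlgebra k M) S
  have := IsScalarTower.restrictScalars k (MonoidAlgebra k M) S
  have := IsSimpleModule.nontrivial (MonoidAlgebra k M) S
  -- Choose `m` minimal in the `J`-order among the elements not annihilating `S`. Then each `x * m`
  -- is either `m` or acts as zero, so the line through `w = m • s` is stable and, by simplicity, is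
  -- all of `S`.
  obtain ⟨m, ⟨s, hms⟩, hmin⟩ : ∃ m : M, (∃ s : S, MonoidAlgebra.of k M m • s ≠ 0) ∧
      ∀ n ∈ principalIdeal m, (∃ s : S, MonoidAlgebra.of k M n • s ≠ 0) → n = m := by
    obtain ⟨s, hs⟩ := exists_ne (0 : S)
    obtain ⟨m, hm, hmin⟩ := Set.exists_min_image
      {m : M | ∃ s : S, MonoidAlgebra.of k M m • s ≠ 0} (fun m => (principalIdeal m).ncard)
      (Set.toFinite _) ⟨1, s, by rwa [map_one, one_smul]⟩
    refine ⟨m, hm, fun n hn hns => hM _ _ (Set.eq_of_subset_of_ncard_le ?_ (hmin n hns)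
      (Set.toFinite _))⟩
    obtain ⟨a, b, rfl⟩ := hn
    rintro _ ⟨x, y, rfl⟩
    exact ⟨x * a, b * y, by simp only [mul_assoc]⟩
  set w := MonoidAlgebra.of k M m • s with hw
  have hact1 : ∀ x : M, x * m = m → MonoidAlgebra.of k M x • w = w := fun x hx => by
    rw [hw, smul_smul, ← map_mul, hx]
  have hact0 : ∀ x : M, x * m ≠ m → MonoidAlgebra.of k M x • w = 0 := fun x hx => by
    rw [hw, smul_smul, ← map_mul]
    by_contra h
    exact hx (hmin _ ⟨x, 1, by rw [mul_one]⟩ ⟨s, h⟩)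
  have hspan : ∀ y : S, ∃ c : k, y = c • w := by
    intro y
    obtain ⟨a, rfl⟩ := IsSimpleModule.toSpanSingleton_surjective (MonoidAlgebra k M) hms y
    rw [LinearMap.toSpanSingleton_apply]
    induction a using MonoidAlgebra.induction_on with
    | of x =>
      by_cases hx : x * m = m
      · exact ⟨1, by rw [hact1 x hx, one_smul]⟩
      · exact ⟨0, by rw [hact0 x hx, zero_smul]⟩
    | add a b ha hb =>
      obtain ⟨c, hc⟩ := ha
      obtain ⟨d, hd⟩ := hb
      exact ⟨c + d, by rw [add_smul, hc, hd, add_smul]⟩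
    | smul r a ha =>
      obtain ⟨c, hc⟩ := ha
      exact ⟨r * c, by rw [smul_assoc, hc, mul_smul]⟩
  have hcomm : ∀ (x : M) (c : k), MonoidAlgebra.of k M x • c • w =
      c • MonoidAlgebra.of k M x • w := fun x c => smul_algebra_smul_comm c _ w
  -- Otherwise `m` kills `w`, hence all of `S`, contrary to its choice.
  have hm : m * m = m := by
    by_contra h
    obtain ⟨c, hc⟩ := hspan s
    exact hms (by rw [hw, hc, hcomm, hact0 m h, smul_zero])
  refine ⟨⟨m, hm⟩, fun x y => ?_⟩
  rw [hM.mem_principalIdeal_iff hm]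
  obtain ⟨c, rfl⟩ := hspan y
  exact ⟨fun hx => by rw [hcomm, hact1 x hx], fun hx => by rw [hcomm, hact0 x hx, smul_zero]⟩

theorem GabrielQuiver.mk_eq_mk_iff {A : Type*} [Ring A] [Algebra k A] {S T : SimpleMod A} :
    GabrielQuiver.mk k S = GabrielQuiver.mk k T ↔ Nonempty (S.1 ≃ₗ[A] T.1) :=
  Quotient.eq (r := simpleModSetoid A)

theorem GabrielQuiver.mk_eq_mk_idemSimpleMod_iff {S : SimpleMod (MonoidAlgebra k M)} :
    GabrielQuiver.mk k S = GabrielQuiver.mk k (idemSimpleMod hM k e) ↔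
      ActsAsIdem k (e : M) S.1 := by
  rw [GabrielQuiver.mk_eq_mk_iff]
  have := S.2
  have := (idemSimpleMod hM k e).2
  exact ⟨fun ⟨i⟩ => (actsAsIdem_quotient_ker hM k e).of_linearEquiv i.symm,
    fun h => h.nonempty_linearEquiv hM k e (actsAsIdem_quotient_ker hM k e)⟩

theorem GabrielQuiver.mk_idemSimpleMod_bijective [Finite M] :
    Function.Bijective (fun e => GabrielQuiver.mk k (idemSimpleMod hM k e)) := by
  constructor
  · intro e f h
    have := (idemSimpleMod hM k e).2
    have := IsSimpleModule.nontrivial (MonoidAlgebra k M) (idemSimpleMod hM k e).1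
    exact ActsAsIdem.eq hM k e f ((mk_eq_mk_idemSimpleMod_iff hM k e).1 rfl)
      ((mk_eq_mk_idemSimpleMod_iff hM k f).1 h)
  · intro x
    obtain ⟨S, rfl⟩ := Quotient.exists_rep x
    have := S.2
    obtain ⟨e, he⟩ := exists_actsAsIdem hM k (S := S.1)
    exact ⟨e, ((mk_eq_mk_idemSimpleMod_iff hM k e).2 he).symm⟩

/-- The arrows of the Gabriel quiver are defined through chosen representatives, so the action must
be known on these. -/
theorem ActsAsIdem.out_mk_idemSimpleMod :
    ActsAsIdem k (e : M) (Quotient.out (GabrielQuiver.mk k (idemSimpleMod hM k e))).1 :=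
  (GabrielQuiver.mk_eq_mk_idemSimpleMod_iff hM k e).1 (Quotient.out_eq _)

/-- Each character kernel is a maximal left ideal. Conversely, the quotient by any maximal left
ideal is a simple module on which `a` acts through some character; applying this to the class of `1`
puts `a` in the ideal. -/
theorem mem_jacobson_monoidAlgebra_iff [Finite M] (a : MonoidAlgebra k M) :
    a ∈ Ring.jacobson (MonoidAlgebra k M) ↔ ∀ e, idemAlgHom hM k e a = 0 := by
  rw [Ring.jacobson, Module.jacobson, Submodule.mem_sInf]
  constructor
  · intro h e
    exact h _ (isCoatom_ker_idemAlgHom hM k e)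
  · intro h I hI
    have : IsSimpleModule (MonoidAlgebra k M) (MonoidAlgebra k M ⧸ I) :=
      isSimpleModule_iff_isCoatom.2 hI
    obtain ⟨e, he⟩ := exists_actsAsIdem hM k (S := MonoidAlgebra k M ⧸ I)
    have h1 := (actsAsIdem_iff hM k e _).1 he a (Submodule.Quotient.mk 1)
    rw [h e, zero_smul, ← Submodule.Quotient.mk_smul, Submodule.Quotient.mk_eq_zero] at h1
    simpa using h1

/-- The product of the characters of the idempotents, on the monoid algebra. -/
noncomputable def idemAlgHomPi :
    MonoidAlgebra k M →ₐ[k] ({e : M // IsIdempotentElem e} → k) :=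
  AlgHom.pi fun e => idemAlgHom hM k e

/-- A nonzero functional vanishing on the range would be a linear relation among distinct
characters, which Dedekind's independence theorem excludes. -/
theorem idemAlgHomPi_surjective [Finite M] : Function.Surjective (idemAlgHomPi hM k) := by
  by_contra hsurj
  have hlt : LinearMap.range (idemAlgHomPi hM k).toLinearMap < ⊤ :=
    lt_top_iff_ne_top.2 fun h => hsurj (LinearMap.range_eq_top.1 h)
  obtain ⟨φ, hφ0, hφ⟩ := Submodule.exists_le_ker_of_lt_top _ hlt
  have := Fintype.ofFinite {e : M // IsIdempotentElem e}
  classical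
  have hφsum : ∀ x : {e : M // IsIdempotentElem e} → k,
      φ x = ∑ e, φ (Pi.single e 1) * x e := fun x => by
    rw [LinearMap.pi_apply_eq_sum_univ φ x]
    exact Finset.sum_congr rfl fun e _ => by
      rw [smul_eq_mul, mul_comm]
      congr 2
      ext j
      simp [Pi.single_apply, eq_comm]
  have hli := (linearIndependent_monoidHom M k).comp _ (idemChar_injective hM k)
  rw [Fintype.linearIndependent_iff] at hli
  have h0 := hli (fun e => φ (Pi.single e 1)) (by
    ext m
    have := hφ ⟨MonoidAlgebra.of k M m, rfl⟩
    rw [LinearMap.mem_ker, hφsum] at this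
    simpa [idemAlgHomPi, Finset.sum_apply] using this)
  exact hφ0 (LinearMap.ext fun x => by rw [hφsum]; simp [h0])

include hM in
/-- The algebra of a finite `J`-trivial monoid is split over any field. -/
theorem isSplitAlgebra_monoidAlgebra [Finite M] : IsSplitAlgebra k (MonoidAlgebra k M) := by
  let E := {e : M // IsIdempotentElem e}
  have hker : RingHom.ker (idemAlgHomPi hM k) = Ring.jacobson (MonoidAlgebra k M) := by
    ext a
    rw [mem_jacobson_monoidAlgebra_iff hM k, RingHom.mem_ker]
    exact funext_iff
  refine ⟨Nat.card E, fun _ => 1, fun _ => one_ne_zero, ⟨?_⟩⟩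
  exact (Ideal.quotientEquivAlgOfEq k hker.symm).trans
    ((Ideal.quotientKerAlgEquivOfSurjective (idemAlgHomPi_surjective hM k)).trans
      ((AlgEquiv.piCongrLeft' k (fun _ => k) (Finite.equivFin E)).trans
        (AlgEquiv.piCongrRight fun _ => (AlgEquiv.ofBijective
          (Algebra.ofId k (Matrix (Fin 1) (Fin 1) k))
          ⟨(Algebra.ofId k (Matrix (Fin 1) (Fin 1) k)).toRingHom.injective, fun A => ⟨A 0 0, by
            ext i j
            obtain rfl := Subsingleton.elim i 0
            obtain rfl := Subsingleton.elim j 0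
            simp [Algebra.ofId_apply, Matrix.algebraMap_matrix_apply]⟩⟩))))

end Simple

/-! ### `Ext¹` from a projective presentation. -/

section ExtOne

open Abelian

open scoped ModuleCat in
/-- If a linear map out of `Hom (ker g, T)`, for a surjection `g : P → S` from a projective module,
is surjective and its kernel consists of the maps that extend to `P`, then its target is
`Ext¹ (S, T)`. -/
theorem ModuleCat.nonempty_ext_one_linearEquiv {k : Type*} [Field k] {A : Type v} [Ring A]
    [Algebra k A] {P S T : ModuleCat.{v} A} [Projective P] (g : P →ₗ[A] S)
    (hg : Function.Surjective g) {W : Type*} [AddCommGroup W] [Module k W]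
    (Φ : (LinearMap.ker g →ₗ[A] T) →ₗ[k] W) (hΦ : Function.Surjective Φ)
    (hker : ∀ φ, Φ φ = 0 ↔ ∃ ψ : P →ₗ[A] T, ψ ∘ₗ (LinearMap.ker g).subtype = φ) :
    Nonempty (Ext S T 1 ≃ₗ[k] W) := by
  have hex := LinearMap.shortExact_shortComplexKer hg
  -- The connecting homomorphism: onto because `Ext¹(P, T) = 0`, with kernel the maps extending to
  -- `P`.
  let δ : (LinearMap.ker g →ₗ[A] T) →ₗ[k] Ext S T 1 :=
    Ext.precompOfLinear hex.extClass k T (add_comm 1 0 : 1 + 0 = 0 + 1) ∘ₗ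
      (Ext.linearEquiv₀ (R := k)).symm.toLinearMap ∘ₗ
        (ModuleCat.homLinearEquiv (S := k)
          (M := ModuleCat.of A (LinearMap.ker g)) (N := T)).symm.toLinearMap
  have hδ (φ) : δ φ = hex.extClass.comp (Ext.mk₀ (ModuleCat.ofHom φ)) (add_comm 1 0) := rfl
  have hsurj : Function.Surjective δ := by
    intro x
    have : Projective g.shortComplexKer.X₂ := inferInstanceAs (Projective P)
    obtain ⟨y, hy⟩ := Ext.contravariant_sequence_exact₃ hex T x
      (Ext.eq_zero_of_projective _) (add_comm 1 0)
    obtain ⟨φ, rfl⟩ := Ext.homEquiv₀.symm.surjective y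
    exact ⟨φ.hom, hy⟩
  have hkerδ : LinearMap.ker δ = LinearMap.ker Φ := by
    ext φ
    rw [LinearMap.mem_ker, LinearMap.mem_ker, hker, hδ]
    constructor
    · intro h
      obtain ⟨y, hy⟩ := Ext.contravariant_sequence_exact₁ hex T _ (add_comm 1 0) h
      obtain ⟨ψ, rfl⟩ := Ext.homEquiv₀.symm.surjective y
      refine ⟨ψ.hom, ?_⟩
      change (Ext.mk₀ _).comp (Ext.mk₀ ψ) _ = _ at hy
      rw [Ext.mk₀_comp_mk₀] at hy
      exact congrArg ModuleCat.Hom.hom (Ext.homEquiv₀.symm.injective hy)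
    · rintro ⟨ψ, rfl⟩
      have : ModuleCat.ofHom (ψ ∘ₗ (LinearMap.ker g).subtype) =
        g.shortComplexKer.f ≫ ModuleCat.ofHom ψ := rfl
      rw [this, ← Ext.mk₀_comp_mk₀, ← Ext.comp_assoc_of_second_deg_zero, hex.extClass_comp,
        Ext.zero_comp]
  exact ⟨(δ.quotKerEquivOfSurjective hsurj).symm ≪≫ₗ Submodule.quotEquivOfEq _ _ hkerδ ≪≫ₗ
    Φ.quotKerEquivOfSurjective hΦ⟩

end ExtOne

/-! ### Derivations for a pair of characters, and irreducible elements. -/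

section Derivation

variable {M : Type u} [Monoid M] (hM : IsJTrivial M) (k : Type v) [Field k]
  (e f : {e : M // IsIdempotentElem e})
  {T : Type*} [AddCommGroup T] [Module k T]

/-- A product `f m n e` is reducible unless `m` is above `f` or `n` is above `e`. -/
theorem not_isIrreducibleBetween_mul (hM : IsJTrivial M) {m n : M}
    (hm : m * (f : M) ≠ f) (hn : n * (e : M) ≠ e) :
    ¬ IsIrreducibleBetween (e : M) (f : M) (f * (m * n) * e) := by
  rintro ⟨-, -, -, -, h⟩
  have he : (e : M) * e = e := e.2
  have hf : (f : M) * f = f := f.2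
  rcases h (f * m) (n * e) (by simp only [mul_assoc]) (by rw [← mul_assoc, hf])
    (by rw [mul_assoc, he]) with h | h
  · exact hn h
  · exact hm ((hM.mul_eq_left_iff f.2).2 h)

theorem idemChar_of_isIrreducibleBetween {m : M}
    (h : IsIrreducibleBetween (e : M) (f : M) m) : idemChar hM k e m = 0 :=
  idemChar_of_ne hM k e (by rw [h.2.1]; exact h.2.2.1)

/-- Functions `d` on `M` satisfying the Leibniz rule for the characters of `f` (on the left) and
`e` (on the right). -/
def IsIdemDerivation (d : M → T) : Prop :=
  ∀ m n : M, d (m * n) = idemChar hM k f m • d n + idemChar hM k e n • d m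

variable {hM k e f}

theorem IsIdemDerivation.map_one {d : M → T} (hd : IsIdemDerivation hM k e f d) : d 1 = 0 := by
  have h := hd 1 1
  rw [mul_one, _root_.map_one, _root_.map_one, one_smul] at h
  exact left_eq_add.1 h

/-- Reduces `d` to its values on `f M e` and at the two idempotents. -/
theorem IsIdemDerivation.map_mul_mul {d : M → T} (hd : IsIdemDerivation hM k e f d) (m : M) :
    d (f * m * e) = d m + idemChar hM k f m • d e + idemChar hM k e m • d f := by
  rw [hd, hd, map_mul, idemChar_self, idemChar_self, one_mul, one_smul, one_smul]
  abel

/-- A derivation that vanishes on the irreducible morphisms vanishes on all morphisms from `e` to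
`f` other than `e` and `f`. -/
theorem IsIdemDerivation.eq_zero_of_ne {d : M → T} (hd : IsIdemDerivation hM k e f d)
    (h0 : ∀ m, IsIrreducibleBetween (e : M) (f : M) m → d m = 0) {x : M}
    (hfx : f * x = x) (hxe : x * e = x) (he : x ≠ e) (hf : x ≠ f) : d x = 0 := by
  by_cases hx : IsIrreducibleBetween (e : M) (f : M) x
  · exact h0 x hx
  · have : ∃ g h : M, x = g * h ∧ f * g = g ∧ h * e = h ∧ h ≠ e ∧ g ≠ f := by
      by_contra hcon
      refine hx ⟨hfx, hxe, he, hf, fun g h h1 h2 h3 => ?_⟩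
      by_contra h4
      rw [not_or] at h4
      exact hcon ⟨g, h, h1, h2, h3, h4.1, h4.2⟩
    obtain ⟨g, h, rfl, hg, hh, hhe, hgf⟩ := this
    -- Both Leibniz terms vanish, as `χ_e(h) = 0` and `χ_f(g) = 0`; no induction on the factors is
    -- needed.
    rw [hd, idemChar_of_ne hM k e (by rwa [hh]), idemChar_of_ne hM k f, zero_smul, zero_smul,
      add_zero]
    rwa [ne_eq, hM.mul_eq_left_iff f.2, hg]

theorem IsIdemDerivation.map_mul_mul_eq_zero {d : M → T} (hd : IsIdemDerivation hM k e f d)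
    (h0 : ∀ m, IsIrreducibleBetween (e : M) (f : M) m → d m = 0) {m : M}
    (he : f * m * e ≠ (e : M)) (hf : f * m * e ≠ (f : M)) : d (f * m * e) = 0 := by
  have he' : (e : M) * e = e := e.2
  have hf' : (f : M) * f = f := f.2
  exact hd.eq_zero_of_ne h0 (by rw [← mul_assoc, ← mul_assoc, hf']) (by rw [mul_assoc, he']) he hf

/-- A derivation that vanishes on the irreducible morphisms is inner. -/
theorem IsIdemDerivation.exists_eq_smul {d : M → T} (hd : IsIdemDerivation hM k e f d)
    (h0 : ∀ m, IsIrreducibleBetween (e : M) (f : M) m → d m = 0) :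
    ∃ c : T, ∀ m, d m = (idemChar hM k f m - idemChar hM k e m) • c := by
  have he : (e : M) * e = e := e.2
  have hf : (f : M) * f = f := f.2
  have hadd : d (f * e) = d e + d f := by
    have := hd.map_mul_mul 1
    rwa [mul_one, hd.map_one, _root_.map_one, _root_.map_one, one_smul, one_smul, zero_add] at this
  -- The cases are `f * e = e`, `f * e = f` and neither. In the first two, `hadd` kills `d f` or `d
  -- e` respectively, and the other value supplies the constant.
  by_cases hfe : (f : M) * e = e
  · have hdf : d f = 0 := by rw [hfe] at hadd; exact left_eq_add.1 hadd
    refine ⟨-d e, fun m => ?_⟩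
    have h1 := hd.map_mul_mul m
    have h2 : d (f * m * e) = idemChar hM k e m • d e := by
      by_cases hm : m * (e : M) = e
      · rw [idemChar_of_eq hM k e hm, mul_assoc, hm, hfe, one_smul]
      · rw [idemChar_of_ne hM k e hm, zero_smul]
        have hne : f * m * e ≠ (e : M) := fun h =>
          hm (hM.mul_eq_of_mem e.2 ⟨f, e, h.symm⟩).2
        by_cases h : f * m * e = (f : M)
        · have h3 := (hM.mul_eq_of_mem f.2 ⟨f * m, 1, by rw [mul_one, h]⟩).1
          rw [h, hdf]
        · exact hd.map_mul_mul_eq_zero h0 hne h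
    rw [h2, hdf, smul_zero, add_zero] at h1
    rw [smul_neg, sub_smul, h1]
    abel
  by_cases hfe' : (f : M) * e = f
  · have hde : d e = 0 := by rw [hfe'] at hadd; exact right_eq_add.1 hadd
    refine ⟨d f, fun m => ?_⟩
    have h1 := hd.map_mul_mul m
    have h2 : d (f * m * e) = idemChar hM k f m • d f := by
      by_cases hm : m * (f : M) = f
      · rw [idemChar_of_eq hM k f hm, (hM.mul_eq_left_iff f.2).1 hm, hfe', one_smul]
      · rw [idemChar_of_ne hM k f hm, zero_smul]
        have hne : f * m * e ≠ (f : M) := fun h =>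
          hm (hM.mul_eq_of_mem f.2 ⟨f, e, h.symm⟩).2
        by_cases h : f * m * e = (e : M)
        · rw [h, hde]
        · exact hd.map_mul_mul_eq_zero h0 h hne
    rw [h2, hde, smul_zero, add_zero] at h1
    rw [sub_smul, h1]
    abel
  -- Now `f M e` contains neither `e` nor `f`, so `d` vanishes on it; at `m = 1` this gives `d e =
  -- -d f`.
  · have hne (m : M) : f * m * e ≠ (e : M) := fun h =>
      hfe (by rw [← h, ← mul_assoc, ← mul_assoc, hf])
    have hne' (m : M) : f * m * e ≠ (f : M) := fun h => hfe' (by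
      conv_lhs => rw [← h]
      rw [mul_assoc, he, h])
    refine ⟨d f, fun m => ?_⟩
    have h1 := hd.map_mul_mul m
    have h2 := hd.map_mul_mul_eq_zero h0 (hne 1) (hne' 1)
    rw [mul_one, hadd] at h2
    rw [hd.map_mul_mul_eq_zero h0 (hne m) (hne' m), eq_neg_of_add_eq_zero_left h2] at h1
    rw [sub_smul, eq_sub_iff_add_eq, ← sub_eq_zero, h1, smul_neg]
    abel

variable (hM k e f)

open Classical in
/-- The derivation that extends a function on the irreducible morphisms from `e` to `f`. -/
noncomputable def irrDerivation (ψ : {m : M // IsIrreducibleBetween (e : M) (f : M) m} → T)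
    (m : M) : T :=
  let ψ' : M → T := fun m => if h : IsIrreducibleBetween (e : M) (f : M) m then ψ ⟨m, h⟩ else 0
  -- The correction forces the value `0` at `1`, as for any derivation, and vanishes on irreducible
  -- elements.
  ψ' (f * m * e) - idemChar hM k e m • ψ' (f * e)

theorem irrDerivation_apply (ψ : {m : M // IsIrreducibleBetween (e : M) (f : M) m} → T)
    (m : {m : M // IsIrreducibleBetween (e : M) (f : M) m}) :
    irrDerivation hM k e f ψ m = ψ m := by
  obtain ⟨m, hm⟩ := m
  have : f * m * e = m := by rw [hm.1, hm.2.1]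
  simp only [irrDerivation]
  rw [idemChar_of_isIrreducibleBetween hM k e f hm, zero_smul, sub_zero, dif_pos (by rwa [this])]
  congr

theorem isIdemDerivation_irrDerivation
    (ψ : {m : M // IsIrreducibleBetween (e : M) (f : M) m} → T) :
    IsIdemDerivation hM k e f (irrDerivation hM k e f ψ) := by
  classical
  intro m n
  unfold irrDerivation
  extract_lets ψ'
  rw [map_mul]
  by_cases hm : m * (f : M) = f
  · rw [idemChar_of_eq hM k f hm, one_smul, ← mul_assoc, (hM.mul_eq_left_iff f.2).1 hm]
    module
  by_cases hn : n * (e : M) = e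
  · have : f * (m * n) * e = f * m * (e : M) := by simp only [mul_assoc, hn]
    rw [idemChar_of_eq hM k e hn, this, idemChar_of_ne hM k f hm]
    module
  · have : ψ' (f * (m * n) * e) = 0 := dif_neg (not_isIrreducibleBetween_mul e f hM hm hn)
    rw [this, idemChar_of_ne hM k e hn, idemChar_of_ne hM k f hm]
    module

variable [Module (MonoidAlgebra k M) T] [IsScalarTower k (MonoidAlgebra k M) T]

/-- The projection of the monoid algebra onto the kernel of the character of `e`. -/
noncomputable def idemKerProj : MonoidAlgebra k M →ₗ[k] RingHom.ker (idemAlgHom hM k e) where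
  toFun a := ⟨a - algebraMap k _ (idemAlgHom hM k e a), by simp [RingHom.mem_ker]⟩
  map_add' a b := by ext1; simp; abel
  map_smul' c a := by ext1; simp [Algebra.smul_def, mul_sub]

theorem coe_idemKerProj (a : MonoidAlgebra k M) :
    (idemKerProj hM k e a : MonoidAlgebra k M) = a - algebraMap k _ (idemAlgHom hM k e a) := rfl

theorem idemKerProj_of_mem (x : RingHom.ker (idemAlgHom hM k e)) :
    idemKerProj hM k e (x : MonoidAlgebra k M) = x := by
  ext1
  rw [coe_idemKerProj, RingHom.mem_ker.1 x.2, map_zero, sub_zero]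

/-- A Leibniz rule with values in `ker χ_e`: composing with a module map to `T` yields a derivation.
-/
theorem idemKerProj_mul (a b : MonoidAlgebra k M) :
    idemKerProj hM k e (a * b) =
      a • idemKerProj hM k e b + idemAlgHom hM k e b • idemKerProj hM k e a := by
  ext1
  simp only [coe_idemKerProj, Submodule.coe_add, SetLike.val_smul_of_tower,
    smul_eq_mul, map_mul]
  rw [Algebra.smul_def, mul_sub, mul_sub, Algebra.commutes (idemAlgHom hM k e b) a,
    Algebra.commutes (idemAlgHom hM k e b) (algebraMap k _ (idemAlgHom hM k e a))]
  abel

theorem isIdemDerivation_comp_idemKerProj (hT : ActsAsIdem k (f : M) T)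
    (φ : RingHom.ker (idemAlgHom hM k e) →ₗ[MonoidAlgebra k M] T) :
    IsIdemDerivation hM k e f fun m => φ (idemKerProj hM k e (MonoidAlgebra.of k M m)) := by
  intro m n
  beta_reduce
  rw [map_mul, idemKerProj_mul, map_add, map_smul, LinearMap.map_smul_of_tower,
    (actsAsIdem_iff hM k f T).1 hT, idemAlgHom_of, idemAlgHom_of]

/-- The linear map on the kernel of the character of `e` defined by a derivation. -/
noncomputable def IsIdemDerivation.toLinearMap {d : M → T} (hd : IsIdemDerivation hM k e f d)
    (hT : ActsAsIdem k (f : M) T) :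
    RingHom.ker (idemAlgHom hM k e) →ₗ[MonoidAlgebra k M] T where
  toFun x := Finsupp.linearCombination k d (MonoidAlgebra.coeff (x : MonoidAlgebra k M))
  map_add' x y := by simp
  map_smul' a x := by
    -- The Leibniz rule extended bilinearly; for `b` in `ker χ_e` the second term drops out, leaving
    -- linearity over `kM`.
    have key : ∀ a b : MonoidAlgebra k M, Finsupp.linearCombination k d (a * b).coeff =
        idemAlgHom hM k f a • Finsupp.linearCombination k d b.coeff +
          idemAlgHom hM k e b • Finsupp.linearCombination k d a.coeff := by
      intro a b
      induction a using MonoidAlgebra.induction_on with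
      | of m =>
        induction b using MonoidAlgebra.induction_on with
        | of n =>
          rw [← map_mul, idemAlgHom_of, idemAlgHom_of]
          simpa [MonoidAlgebra.of_apply] using hd m n
        | add x y hx hy =>
          rw [mul_add, MonoidAlgebra.coeff_add, map_add, hx, hy, MonoidAlgebra.coeff_add, map_add,
            map_add]
          module
        | smul r x hx =>
          rw [mul_smul_comm, MonoidAlgebra.coeff_smul, map_smul, hx, MonoidAlgebra.coeff_smul,
            map_smul, map_smul, smul_eq_mul]
          module
      | add x y hx hy =>
        rw [add_mul, MonoidAlgebra.coeff_add, map_add, hx, hy, MonoidAlgebra.coeff_add, map_add,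
          map_add]
        module
      | smul r x hx =>
        rw [smul_mul_assoc, MonoidAlgebra.coeff_smul, map_smul, hx, MonoidAlgebra.coeff_smul,
          map_smul, map_smul, smul_eq_mul]
        module
    rw [Submodule.coe_smul, smul_eq_mul, key, RingHom.mem_ker.1 x.2, zero_smul, add_zero,
      RingHom.id_apply, (actsAsIdem_iff hM k f T).1 hT]

/-- `Φ` evaluates the associated derivation on irreducible elements. The ideal is a variable so that
the kernel of `kM → S` can be substituted for it. -/
theorem exists_linearMap_irr (hT : ActsAsIdem k (f : M) T) (I : Ideal (MonoidAlgebra k M))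
    (hI : I = RingHom.ker (idemAlgHom hM k e)) :
    ∃ Φ : (I →ₗ[MonoidAlgebra k M] T) →ₗ[k]
        ({m : M // IsIrreducibleBetween (e : M) (f : M) m} → T),
      Function.Surjective Φ ∧
        ∀ φ, Φ φ = 0 ↔ ∃ ψ : MonoidAlgebra k M →ₗ[MonoidAlgebra k M] T, ψ ∘ₗ I.subtype = φ := by
  subst hI
  have hT' := (actsAsIdem_iff hM k f T).1 hT
  refine ⟨{ toFun := fun φ m => φ (idemKerProj hM k e (MonoidAlgebra.of k M m))
            map_add' := fun _ _ => rfl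
            map_smul' := fun _ _ => rfl }, fun ψ => ?_, fun φ => ?_⟩
  · refine ⟨(isIdemDerivation_irrDerivation hM k e f ψ).toLinearMap hM k e f hT, ?_⟩
    ext m
    change Finsupp.linearCombination k _ (MonoidAlgebra.coeff (idemKerProj hM k e _).1) = ψ m
    rw [coe_idemKerProj, idemAlgHom_of, idemChar_of_isIrreducibleBetween hM k e f m.2, map_zero,
      sub_zero, MonoidAlgebra.of_apply, MonoidAlgebra.coeff_single,
      Finsupp.linearCombination_single, one_smul, irrDerivation_apply]
  · constructor
    · intro h
      obtain ⟨c, hc⟩ := (isIdemDerivation_comp_idemKerProj hM k e f hT φ).exists_eq_smul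
        fun m hm => congrFun h ⟨m, hm⟩
      have key : ∀ a, φ (idemKerProj hM k e a) =
          (idemAlgHom hM k f a - idemAlgHom hM k e a) • c := by
        intro a
        induction a using MonoidAlgebra.induction_on with
        | of m => rw [hc, idemAlgHom_of, idemAlgHom_of]
        | add x y hx hy => rw [map_add, map_add, hx, hy, map_add, map_add]; module
        | smul r x hx =>
          rw [map_smul, LinearMap.map_smul_of_tower, hx, map_smul, map_smul, smul_eq_mul,
            smul_eq_mul]
          module
      -- The extension sends `1` to `c`: on `ker χ_e` the inner formula reads `χ_f(x) c`, which is
      -- `x • c`.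
      refine ⟨LinearMap.toSpanSingleton _ _ c, LinearMap.ext fun x => ?_⟩
      rw [← idemKerProj_of_mem hM k e x, key, RingHom.mem_ker.1 x.2, sub_zero,
        idemKerProj_of_mem, ← hT']
      rfl
    · rintro ⟨ψ, rfl⟩
      ext m
      have h1 : ψ (idemKerProj hM k e (MonoidAlgebra.of k M m)).1 =
          (idemKerProj hM k e (MonoidAlgebra.of k M m)).1 • ψ 1 := by
        rw [← map_smul, smul_eq_mul, mul_one]
      have h2 : idemChar hM k f m = 0 :=
        idemChar_of_ne hM k f fun h => m.2.2.2.2.1 <|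
          m.2.1.symm.trans ((hM.mul_eq_left_iff f.2).1 h)
      change ψ (idemKerProj hM k e _).1 = 0
      rw [h1, coe_idemKerProj, idemAlgHom_of, idemChar_of_isIrreducibleBetween hM k e f m.2,
        map_zero, sub_zero, hT', idemAlgHom_of, h2, zero_smul]

end Derivation

/-! ### Comparison of the two quivers. -/

section Main

variable {M : Type u} [Monoid M] (hM : IsJTrivial M) (k : Type v) [Field k]
  (e f : {e : M // IsIdempotentElem e})

include hM in
open scoped ModuleCat in
/-- The dimension of `Ext¹` between the simple modules of two idempotents is the number of
irreducible morphisms between them. -/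
theorem rank_ext_one_eq_card [Finite M] {S T : ModuleCat.{max u v} (MonoidAlgebra k M)}
    [IsSimpleModule (MonoidAlgebra k M) S] [IsSimpleModule (MonoidAlgebra k M) T]
    (hS : ActsAsIdem k (e : M) S) (hT : ActsAsIdem k (f : M) T) :
    Module.rank k (Abelian.Ext S T 1) =
      Nat.card {m : M // IsIrreducibleBetween (e : M) (f : M) m} := by
  have := IsSimpleModule.nontrivial (MonoidAlgebra k M) S
  obtain ⟨s, hs⟩ := exists_ne (0 : S)
  obtain ⟨Φ, hΦ, hker⟩ := exists_linearMap_irr hM k e f hT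
    (LinearMap.ker (LinearMap.toSpanSingleton (MonoidAlgebra k M) S s))
    (hS.ker_toSpanSingleton hM k e hs)
  have : Projective (ModuleCat.of (MonoidAlgebra k M) (MonoidAlgebra k M)) :=
    (IsProjective.iff_projective _).1 inferInstance
  obtain ⟨i⟩ := ModuleCat.nonempty_ext_one_linearEquiv
    (P := ModuleCat.of (MonoidAlgebra k M) (MonoidAlgebra k M))
    (LinearMap.toSpanSingleton (MonoidAlgebra k M) S s)
    (IsSimpleModule.toSpanSingleton_surjective _ hs) Φ hΦ hker
  have hT1 : Module.finrank k T = 1 := hT.finrank_eq_one hM k f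
  have : Module.Finite k T := Module.finite_of_finrank_eq_succ hT1
  have := Fintype.ofFinite {m : M // IsIrreducibleBetween (e : M) (f : M) m}
  have : Module.Finite k (Abelian.Ext S T 1) := Module.Finite.equiv i.symm
  rw [← Module.finrank_eq_rank, i.finrank_eq, Module.finrank_pi_fintype]
  simp [hT1]

theorem nonempty_gabrielQuiver_hom_equiv [Finite M] :
    Nonempty ((GabrielQuiver.mk k (idemSimpleMod hM k e) ⟶
        GabrielQuiver.mk k (idemSimpleMod hM k f)) ≃
      IrrHom (MonoidKaroubi.ofIdem e) (MonoidKaroubi.ofIdem f)) := by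
  have hS := ActsAsIdem.out_mk_idemSimpleMod hM k e
  have hT := ActsAsIdem.out_mk_idemSimpleMod hM k f
  have := (Quotient.out (GabrielQuiver.mk k (idemSimpleMod hM k e))).2
  have := (Quotient.out (GabrielQuiver.mk k (idemSimpleMod hM k f))).2
  have h := rank_ext_one_eq_card hM k e f hS hT
  obtain ⟨i⟩ : Nonempty (Quotient.out (Module.rank k (Abelian.Ext
      (Quotient.out (GabrielQuiver.mk k (idemSimpleMod hM k e))).1
      (Quotient.out (GabrielQuiver.mk k (idemSimpleMod hM k f))).1 1)) ≃
      {m : M // IsIrreducibleBetween (e : M) (f : M) m}) := by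
    rw [← Cardinal.lift_mk_eq', Cardinal.mk_out, h, Cardinal.lift_natCast,
      ← Nat.cast_card (α := {m : M // IsIrreducibleBetween (e : M) (f : M) m}),
      Cardinal.lift_natCast]
  exact ⟨i.trans (MonoidKaroubi.irrHomEquiv hM e f).symm⟩

end Main

theorem mainTheorem9 (M : Type u) [Monoid M] [Finite M] (hM : IsJTrivial M)
    (k : Type v) [Field k] :
    IsSplitAlgebra k (MonoidAlgebra k M) ∧
    Function.Bijective (fun e : {e : M // IsIdempotentElem e} =>
      CatQuiver.mk (MonoidKaroubi.ofIdem e)) ∧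
    ∃ Θ : QuiverIso (CatQuiver (MonoidKaroubi M)) (GabrielQuiver k (MonoidAlgebra k M)),
      ∀ e : {e : M // IsIdempotentElem e},
        (∀ S : SimpleMod (MonoidAlgebra k M),
          GabrielQuiver.mk k S = Θ.vertexEquiv (CatQuiver.mk (MonoidKaroubi.ofIdem e)) ↔
            ActsAsIdem k (e : M) S.1) ∧
        ∀ f : {f : M // IsIdempotentElem f},
          Nonempty
            ((Θ.vertexEquiv (CatQuiver.mk (MonoidKaroubi.ofIdem e)) ⟶
                Θ.vertexEquiv (CatQuiver.mk (MonoidKaroubi.ofIdem f))) ≃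
              IrrHom (MonoidKaroubi.ofIdem e) (MonoidKaroubi.ofIdem f)) := by
  have hbij := CatQuiver.mk_ofIdem_bijective hM
  let V := (Equiv.ofBijective _ hbij).symm.trans
    (Equiv.ofBijective _ (GabrielQuiver.mk_idemSimpleMod_bijective hM k))
  have hV (e) : V (CatQuiver.mk (MonoidKaroubi.ofIdem e)) =
      GabrielQuiver.mk k (idemSimpleMod hM k e) :=
    congrArg (fun e => GabrielQuiver.mk k (idemSimpleMod hM k e))
      ((Equiv.ofBijective _ hbij).symm_apply_apply e)
  have harrow (e f) : Nonempty ((V (CatQuiver.mk (MonoidKaroubi.ofIdem e)) ⟶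
      V (CatQuiver.mk (MonoidKaroubi.ofIdem f))) ≃
        IrrHom (MonoidKaroubi.ofIdem e) (MonoidKaroubi.ofIdem f)) := by
    rw [hV, hV]
    exact nonempty_gabrielQuiver_hom_equiv hM k e f
  have hiso (a b : CatQuiver (MonoidKaroubi M)) : Nonempty ((a ⟶ b) ≃ (V a ⟶ V b)) := by
    obtain ⟨e, rfl⟩ := hbij.2 a
    obtain ⟨f, rfl⟩ := hbij.2 b
    obtain ⟨i⟩ := harrow e f
    change Nonempty (IrrHom (Quotient.out (CatQuiver.mk (MonoidKaroubi.ofIdem e)))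
      (Quotient.out (CatQuiver.mk (MonoidKaroubi.ofIdem f))) ≃ _)
    -- Isomorphism classes are singletons, so the chosen representatives are the given objects.
    rw [CatQuiver.out_mk hM, CatQuiver.out_mk hM]
    exact ⟨i.symm⟩
  refine ⟨isSplitAlgebra_monoidAlgebra hM k, hbij,
    ⟨V, fun a b => (hiso a b).some⟩, fun e => ⟨fun S => ?_, harrow e⟩⟩
  change GabrielQuiver.mk k S = V _ ↔ _
  rw [hV]
  exact GabrielQuiver.mk_eq_mk_idemSimpleMod_iff hM k e
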